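/- Let $d,d'\ge 1$, $T>0$, $\mathcal O=[0,T]\times\mathbb R^d$, let $\mathcal D\subseteq\mathcal O$ be closed and $\mathcal C=\mathcal O\setminus\mathcal D$. For $A\subseteq\mathcal O$ let $\overline A$ be its closure, $A_t=A\cap(\{t\}\times\mathbb R^d)$ and $A_{[s,t)}=A\cap([s,t)\times\mathbb R^d)$. Put $$\partial\mathcal D_{[0,T)}=(\overline{\mathcal C}\cap\mathcal D)_{[0,T)},\qquad \mathcal D^\circ_T=\mathcal D_T\setminus\overline{\mathcal C_T},\qquad \partial\mathcal C_T=\mathcal D_T\cap\overline{\mathcal C_T}.$$ Let $\mu:\mathcal O\to\mathbb R^d$ and $\sigma:\mathcal O\to\mathbb R^{d\times d'}$ be measurable, locally Lipschitz in $x$ and of linear growth in $x$, uniformly in $t\in[0,T]$. On a filtered probability space $(\Omega,\mathcal G,(\mathcal G_s)_{s\in[0,T]},\mathsf Q)$ with a $d'$-dimensional Brownian motion $W$, let, for $(t,z)\in\mathcal O$, $Z^{t,z}$ be the continuous adapted solution of $$Z_s=z+\int_t^s\mu(r,Z_r)\,dr+\int_t^s\sigma(r,Z_r)\,dW_r,\qquad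 s\in[t,T],$$ and let $\tau^{t,z}_{\mathcal D}=\inf\{s\in[t,T]:(s,Z^{t,z}_s)\in\mathcal D\}$, with $\inf\varnothing=\infty$. Let $f:\mathcal O\to[0,\infty)$ and $g:\mathbb R^d\to[0,\infty)$ be measurable and define $$u(t,z)=\mathsf E^{\mathsf Q}\Big[\exp\Big(-\tfrac12\int_t^Tf(s,Z^{t,z}_s)\,ds-\tfrac12 g(Z^{t,z}_T)\Big)1_{\{T<\tau^{t,z}_{\mathcal D}\}}\Big],\qquad (t,z)\in\mathcal O.$$ Assume that $f$ is continuous on $\overline{\mathcal C}$ and that $g$, regarded as the function $(T,x)\mapsto g(x)$, is continuous on $\overline{\mathcal C_T}$; that for every $\delta>0$ and every sequence $(t_n,z_n)$ in $\mathcal O$ converging to some $(t,z)\in\mathcal O$ $$\lim_{n\to\infty}\mathsf E^{\mathsf Q}\Big[\sup_{s\in[0,\delta]}\big|Z^{t_n,z_n}_{(t_n+s)\wedge T}-Z^{t,z}_{(t+s)\wedge T}\big|\Big]=0;$$ and that $\mathsf Q\big((T,Z^{t,z}_T)\in\partial\mathcal C_T\big)=0$ for all $(t,z)\in[0,T)\times\mathbb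 R^d$. For $(t,z)\in\mathcal O$ consider the condition $$(\mathrm R)\qquad \lim_{n\to\infty}\mathsf Q\big(\big|\tau^{t_n,z_n}_{\mathcal D}\wedge(2T)-\tau^{t,z}_{\mathcal D}\wedge(2T)\big|>\varepsilon\big)=0\quad\text{for all }\varepsilon>0\text{ and all sequences }(t_n,z_n)\text{ in }\mathcal C\text{ converging to }(t,z).$$ Then: (a) If $(t,z)\in\mathcal C$ satisfies $(\mathrm R)$, then $\lim_{n\to\infty}u(t_n,z_n)=u(t,z)$ for every sequence $(t_n,z_n)$ in $\mathcal C$ converging to $(t,z)$. (b) If $(t,z)\in\partial\mathcal D_{[0,T)}\cup\mathcal D^\circ_T$ satisfies $(\mathrm R)$, then $u(t,z)=0$ and $\lim_{n\to\infty}u(t_n,z_n)=0$ for every sequence $(t_n,z_n)$ in $\mathcal C$ converging to $(t,z)$. (c) If $(\mathrm R)$ holds at every $(t,z)\in\mathcal C\cup\partial\mathcal D_{[0,T)}\cup\mathcal D^\circ_T$, then $u$ is continuous on $\mathcal O\setminus\partial\mathcal C_T$. -/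

import Mathlib

open MeasureTheory ProbabilityTheory Set Filter Topology
open scoped ENNReal NNReal Matrix

noncomputable section

namespace ConstrainedDiffusion

/-- `ℝᵈ` with the Euclidean norm. -/
abbrev Space (d : ℕ) : Type := EuclideanSpace ℝ (Fin d)

/-- Time-space points `(t, x)`. -/
abbrev TimeSpace (d : ℕ) : Type := ℝ × Space d

/-! ### Time-space sets

`𝒪 = [0, T] × ℝᵈ` is closed in `ℝ × ℝᵈ`, so for subsets of `𝒪` the closure in `ℝ × ℝᵈ` is the
closure in `𝒪`. -/

/-- `𝒪 = [0, T] × ℝᵈ`. -/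
def cyl (d : ℕ) (T : ℝ) : Set (TimeSpace d) := Icc 0 T ×ˢ univ

/-- `𝒞 = 𝒪 ∖ 𝒟`. -/
def contSet {d : ℕ} (T : ℝ) (D : Set (TimeSpace d)) : Set (TimeSpace d) := cyl d T \ D

/-- `A_t = A ∩ ({t} × ℝᵈ)`. -/
def slice {d : ℕ} (A : Set (TimeSpace d)) (t : ℝ) : Set (TimeSpace d) := A ∩ ({t} ×ˢ univ)

/-- `A_{[s, t)} = A ∩ ([s, t) × ℝᵈ)`. -/
def slab {d : ℕ} (A : Set (TimeSpace d)) (s t : ℝ) : Set (TimeSpace d) := A ∩ (Ico s t ×ˢ univ)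

/-- `∂𝒟_{[0, T)} = (closure 𝒞 ∩ 𝒟)_{[0, T)}`. -/
def lateralBdry {d : ℕ} (T : ℝ) (D : Set (TimeSpace d)) : Set (TimeSpace d) :=
  slab (closure (contSet T D) ∩ D) 0 T

/-- `𝒟°_T = 𝒟_T ∖ closure 𝒞_T`. -/
def terminalInt {d : ℕ} (T : ℝ) (D : Set (TimeSpace d)) : Set (TimeSpace d) :=
  slice D T \ closure (slice (contSet T D) T)

/-- `∂𝒞_T = 𝒟_T ∩ closure 𝒞_T`. -/
def terminalBdry {d : ℕ} (T : ℝ) (D : Set (TimeSpace d)) : Set (TimeSpace d) :=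
  slice D T ∩ closure (slice (contSet T D) T)

/-! ### Brownian motion, Itô integral and the stochastic differential equation -/

/-- The squared Euclidean (Frobenius) norm of a matrix. -/
def frobSq {d d' : ℕ} (A : Matrix (Fin d) (Fin d') ℝ) : ℝ := ∑ i, ∑ j, A i j ^ 2

/-- The Euclidean (Frobenius) norm of a matrix. -/
def frob {d d' : ℕ} (A : Matrix (Fin d) (Fin d') ℝ) : ℝ := √(frobSq A)

/-- The vector `A v`. -/
def mulVecE {d d' : ℕ} (A : Matrix (Fin d) (Fin d') ℝ) (v : Space d') : Space d :=
  WithLp.toLp 2 (A *ᵥ WithLp.ofLp v)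

/-- `(W_s)_{s ∈ [0, T]}` is a `d'`-dimensional Brownian motion relative to the filtration
`(𝓖_s)_{s ∈ [0, T]}`. Only the values of `𝓖` and `W` on `[0, T]` matter. -/
structure IsBrownianOn {Ω : Type*} {m : MeasurableSpace Ω} {d' : ℕ} (Q : Measure Ω)
    (𝓖 : Filtration ℝ m) (T : ℝ) (W : ℝ → Ω → Space d') : Prop where
  adapted : ∀ s ∈ Icc 0 T, Measurable[𝓖 s] (W s)
  continuous_paths : ∀ ω, ContinuousOn (fun s => W s ω) (Icc 0 T)
  start : ∀ᵐ ω ∂Q, W 0 ω = 0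
  increments_law : ∀ r s, 0 ≤ r → r ≤ s → s ≤ T →
    HasLaw (fun ω => W s ω - W r ω)
      (multivariateGaussian 0 ((s - r) • (1 : Matrix (Fin d') (Fin d') ℝ))) Q
  increments_indep : ∀ r s, 0 ≤ r → r ≤ s → s ≤ T →
    Indep (MeasurableSpace.comap (fun ω => W s ω - W r ω) inferInstance) (𝓖 r) Q

/-- A simple (piecewise constant, bounded, predictable) matrix-valued process on `[t, T]`:
`∑_{k < N} ξ_k 1_{(r_k, r_{k+1}]}` with `t ≤ r_0 ≤ … ≤ r_N ≤ T` and `ξ_k` bounded and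
`𝓖_{r_k}`-measurable. -/
structure SimpleProc {Ω : Type*} {m : MeasurableSpace Ω} (d d' : ℕ) (𝓖 : Filtration ℝ m)
    (t T : ℝ) where
  N : ℕ
  r : ℕ → ℝ
  mono : Monotone r
  mem : ∀ k, r k ∈ Icc t T
  ξ : ℕ → Ω → Matrix (Fin d) (Fin d') ℝ
  meas : ∀ k i j, Measurable[𝓖 (r k)] (fun ω => ξ k ω i j)
  bdd : ∃ c : ℝ, ∀ k ω i j, |ξ k ω i j| ≤ c

/-- The value of a simple process at time `s`. -/
def SimpleProc.val {Ω : Type*} {m : MeasurableSpace Ω} {d d' : ℕ} {𝓖 : Filtration ℝ m}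
    {t T : ℝ} (H : SimpleProc d d' 𝓖 t T) (s : ℝ) (ω : Ω) : Matrix (Fin d) (Fin d') ℝ :=
  ∑ k ∈ Finset.range H.N, (Ioc (H.r k) (H.r (k + 1))).indicator (fun _ => H.ξ k ω) s

/-- The elementary stochastic integral `∫_t^s H dW` of a simple process. -/
def SimpleProc.integral {Ω : Type*} {m : MeasurableSpace Ω} {d d' : ℕ} {𝓖 : Filtration ℝ m}
    {t T : ℝ} (H : SimpleProc d d' 𝓖 t T) (W : ℝ → Ω → Space d') (s : ℝ) (ω : Ω) : Space d :=
  ∑ k ∈ Finset.range H.N,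
    mulVecE (H.ξ k ω) (W (min (H.r (k + 1)) s) ω - W (min (H.r k) s) ω)

/-- `(I_s)_{s ∈ [t, T]}` is (a version of) the Itô integral `∫_t^s H_u dW_u`: the integrand `H` is
progressively measurable with `∫_t^T |H_u|² du < ∞` almost surely, and `I` is the limit, uniformly
on `[t, T]` in probability, of the elementary integrals of simple processes `Hₙ` such that
`∫_t^T |Hₙ - H|² du → 0` in probability. This determines `I` up to indistinguishability. -/
structure IsItoIntegral {Ω : Type*} {m : MeasurableSpace Ω} {d d' : ℕ} (Q : Measure Ω)
    (𝓖 : Filtration ℝ m) (t T : ℝ) (W : ℝ → Ω → Space d')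
    (H : ℝ → Ω → Matrix (Fin d) (Fin d') ℝ) (I : ℝ → Ω → Space d) : Prop where
  progressive : ∀ s ∈ Icc t T, ∀ i j,
    Measurable[Subtype.instMeasurableSpace.prod (𝓖 s)] (fun p : Icc t s × Ω => H p.1 p.2 i j)
  sq_integrable : ∀ᵐ ω ∂Q, ∫⁻ s in Icc t T, ENNReal.ofReal (frobSq (H s ω)) < ∞
  approx : ∃ Hn : ℕ → SimpleProc d d' 𝓖 t T,
    (∀ ε : ℝ≥0∞, 0 < ε → Tendsto (fun n => Q {ω |
        ε < ∫⁻ s in Icc t T, ENNReal.ofReal (frobSq ((Hn n).val s ω - H s ω))}) atTop (𝓝 0)) ∧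
    (∀ ε : ℝ≥0∞, 0 < ε → Tendsto (fun n => Q {ω |
        ε < ⨆ s ∈ Icc t T, ‖(Hn n).integral W s ω - I s ω‖ₑ}) atTop (𝓝 0))

/-- `(Z_s)_{s ∈ [t, T]}` is a continuous adapted solution, on the given filtered probability space
and with the given Brownian motion, of
`Z_s = z + ∫_t^s μ(u, Z_u) du + ∫_t^s σ(u, Z_u) dW_u`, `s ∈ [t, T]`.
If `𝓖` is the augmented Brownian filtration, this is the definition of a strong solution. -/
structure IsSDESolution {Ω : Type*} {m : MeasurableSpace Ω} {d d' : ℕ} (Q : Measure Ω)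
    (𝓖 : Filtration ℝ m) (T : ℝ) (W : ℝ → Ω → Space d') (μ : TimeSpace d → Space d)
    (σ : TimeSpace d → Matrix (Fin d) (Fin d') ℝ) (t : ℝ) (z : Space d)
    (Z : ℝ → Ω → Space d) : Prop where
  adapted : ∀ s ∈ Icc t T, Measurable[𝓖 s] (Z s)
  continuous_paths : ∀ ω, ContinuousOn (fun s => Z s ω) (Icc t T)
  drift_integrable : ∀ᵐ ω ∂Q, IntegrableOn (fun u => μ (u, Z u ω)) (Icc t T)
  equation : ∃ I : ℝ → Ω → Space d,
    IsItoIntegral Q 𝓖 t T W (fun u ω => σ (u, Z u ω)) I ∧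
    ∀ᵐ ω ∂Q, ∀ s ∈ Icc t T, Z s ω = z + (∫ u in t..s, μ (u, Z u ω)) + I s ω

/-- Standing conditions on the coefficients `μ`, `σ` on `[0, T] × ℝᵈ`: measurable, locally
Lipschitz in `x` and of linear growth in `x`, uniformly in `t ∈ [0, T]`. -/
structure CoeffConditions {d d' : ℕ} (T : ℝ) (μ : TimeSpace d → Space d)
    (σ : TimeSpace d → Matrix (Fin d) (Fin d') ℝ) : Prop where
  measurable_drift : Measurable (fun p : cyl d T => μ p)
  measurable_diffusion : ∀ i j, Measurable (fun p : cyl d T => σ p i j)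
  locally_lipschitz : ∀ R : ℝ, ∃ L : ℝ, ∀ t ∈ Icc 0 T, ∀ x y : Space d, ‖x‖ ≤ R → ‖y‖ ≤ R →
    ‖μ (t, x) - μ (t, y)‖ + frob (σ (t, x) - σ (t, y)) ≤ L * ‖x - y‖
  linear_growth : ∃ K : ℝ, ∀ t ∈ Icc 0 T, ∀ x : Space d,
    ‖μ (t, x)‖ + frob (σ (t, x)) ≤ K * (1 + ‖x‖)

/-! ### Hitting times and the function `u`

In what follows `Z t z` is the process `Z^{t,z}` started at time `t` from `z`. -/

/-- `τ_𝒟^{t,z} = inf {s ∈ [t, T] : (s, Z^{t,z}_s) ∈ 𝒟}`, with `inf ∅ = ∞`. -/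
def hitTime {Ω : Type*} {d : ℕ} (T : ℝ) (D : Set (TimeSpace d))
    (Z : ℝ → Space d → ℝ → Ω → Space d) (p : TimeSpace d) (ω : Ω) : EReal :=
  sInf ((fun s : ℝ => (s : EReal)) '' {s | s ∈ Icc p.1 T ∧ (s, Z p.1 p.2 s ω) ∈ D})

/-- The real number `τ_𝒟^{t,z} ∧ (2T)`. -/
def hitTimeTrunc {Ω : Type*} {d : ℕ} (T : ℝ) (D : Set (TimeSpace d))
    (Z : ℝ → Space d → ℝ → Ω → Space d) (p : TimeSpace d) (ω : Ω) : ℝ :=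
  (min (hitTime T D Z p ω) ((2 * T : ℝ) : EReal)).toReal

/-- `u(t, z) = E[exp(-½ ∫_t^T f(s, Z_s) ds - ½ g(Z_T)) 1_{T < τ_𝒟}]` for `Z = Z^{t,z}`.
When `f` is continuous on the closure of `𝒞` and `Z` has continuous paths, the time integral is
a proper one on the event `T < τ_𝒟`. -/
def uFun {Ω : Type*} {m : MeasurableSpace Ω} {d : ℕ} (Q : Measure Ω) (T : ℝ)
    (D : Set (TimeSpace d)) (f : TimeSpace d → ℝ) (g : Space d → ℝ)
    (Z : ℝ → Space d → ℝ → Ω → Space d) (p : TimeSpace d) : ℝ :=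
  ∫ ω, {ω | (T : EReal) < hitTime T D Z p ω}.indicator
    (fun ω => Real.exp (-(1 / 2) * (∫ s in p.1..T, f (s, Z p.1 p.2 s ω))
      - (1 / 2) * g (Z p.1 p.2 T ω))) ω ∂Q

/-- Continuous dependence on the initial condition: for all `δ > 0` and `(tₙ, zₙ) → (t, z)` in `𝒪`,
`E[sup_{s ∈ [0, δ]} |Z^{tₙ,zₙ}_{(tₙ+s)∧T} - Z^{t,z}_{(t+s)∧T}|] → 0`. -/
def FlowContinuous {Ω : Type*} {m : MeasurableSpace Ω} {d : ℕ} (Q : Measure Ω) (T : ℝ)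
    (Z : ℝ → Space d → ℝ → Ω → Space d) : Prop :=
  ∀ δ : ℝ, 0 < δ → ∀ p ∈ cyl d T, ∀ q : ℕ → TimeSpace d, (∀ n, q n ∈ cyl d T) →
    Tendsto q atTop (𝓝 p) →
    Tendsto (fun n => ∫⁻ ω, ⨆ s ∈ Icc (0 : ℝ) δ,
      ‖Z (q n).1 (q n).2 (min ((q n).1 + s) T) ω - Z p.1 p.2 (min (p.1 + s) T) ω‖ₑ ∂Q)
      atTop (𝓝 0)

/-- `Q((T, Z^{t,z}_T) ∈ ∂𝒞_T) = 0` for all `(t, z) ∈ [0, T) × ℝᵈ`. -/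
def AvoidsTerminalBdry {Ω : Type*} {m : MeasurableSpace Ω} {d : ℕ} (Q : Measure Ω) (T : ℝ)
    (D : Set (TimeSpace d)) (Z : ℝ → Space d → ℝ → Ω → Space d) : Prop :=
  ∀ t ∈ Ico 0 T, ∀ z : Space d, Q {ω | (T, Z t z T ω) ∈ terminalBdry T D} = 0

/-- At `p = (t, z)`: for every sequence `(tₙ, zₙ)` in `𝒞` converging to `(t, z)`,
`τ_𝒟^{tₙ,zₙ} ∧ (2T) → τ_𝒟^{t,z} ∧ (2T)` in probability. -/
def HitTimeContinuousAt {Ω : Type*} {m : MeasurableSpace Ω} {d : ℕ} (Q : Measure Ω) (T : ℝ)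
    (D : Set (TimeSpace d)) (Z : ℝ → Space d → ℝ → Ω → Space d) (p : TimeSpace d) : Prop :=
  ∀ q : ℕ → TimeSpace d, (∀ n, q n ∈ contSet T D) → Tendsto q atTop (𝓝 p) →
    ∀ ε : ℝ, 0 < ε → Tendsto (fun n =>
      Q {ω | ε < |hitTimeTrunc T D Z (q n) ω - hitTimeTrunc T D Z p ω|}) atTop (𝓝 0)

end ConstrainedDiffusion

end

/-! The mechanism is a gap: `τ ∧ 2T` equals `2T` on the survival event `T < τ` and is at most `T`
off it. If truncated hitting times converge at some `ω`, the survival indicators are therefore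
eventually constant there (`eventually_lt_hitTime_iff`). On survival, all paths concerned stay in
`𝒞`, where `f` and `g` have the continuity needed, so uniform convergence of the paths makes the
exponents converge (`tendsto_payoff`).

The flow hypothesis and (R) supply both pathwise convergences almost surely along a subsequence. The
payoff lies in `[0, 1]`, so dominated convergence and the subsequence principle give `u(q n) → u(p)`
at every `p` in `𝒪` where (R) holds (`tendsto_uFun`). This covers (a) and, because `u = 0` on `𝒟`
(`uFun_eq_zero_of_mem`), also (b). For (c), `𝒪` splits into `𝒞`, where (a) and (b) apply, and `𝒟`,
where `u` vanishes. -/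

namespace ConstrainedDiffusion

/-! ### Measurability of suprema, subsequences, and convergence of the running cost -/

section Analysis

/-- Over a separable index space, the supremum of a family of measurable functions which is
continuous in the index is measurable. -/
theorem measurable_iSup_of_continuous {ι Ω : Type*} [TopologicalSpace ι] [TopologicalSpace.SeparableSpace ι]
    [MeasurableSpace Ω] {h : ι → Ω → ℝ≥0∞} (hc : ∀ ω, Continuous fun i => h i ω)
    (hm : ∀ i, Measurable (h i)) : Measurable fun ω => ⨆ i, h i ω := by
  obtain ⟨s, hs, hd⟩ := TopologicalSpace.exists_countable_dense ι
  have : (fun ω => ⨆ i, h i ω) = fun ω => ⨆ i ∈ s, h i ω := by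
    funext ω
    refine le_antisymm (iSup_le fun i => ?_) (iSup₂_le fun i _ => le_iSup (fun i => h i ω) i)
    have hcl : IsClosed {i | h i ω ≤ ⨆ i ∈ s, h i ω} := isClosed_le (hc ω) continuous_const
    exact hcl.closure_subset_iff.2 (fun i hi => le_iSup₂ (f := fun i _ => h i ω) i hi) (hd i)
  rw [this]
  exact Measurable.biSup s hs fun i _ => hm i

/-- A sequence of measurable functions with integrals tending to zero has a subsequence tending
to zero almost everywhere. -/
theorem exists_subseq_ae_tendsto_zero_of_lintegral {Ω : Type*} [MeasurableSpace Ω] {Q : Measure Ω}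
    {X : ℕ → Ω → ℝ≥0∞} (hX : ∀ n, Measurable (X n))
    (h : Tendsto (fun n => ∫⁻ ω, X n ω ∂Q) atTop (𝓝 0)) :
    ∃ ns : ℕ → ℕ, StrictMono ns ∧ ∀ᵐ ω ∂Q, Tendsto (fun i => X (ns i) ω) atTop (𝓝 0) := by
  -- Truncation at 1 makes the variables real-valued and leaves values below 1 unchanged, so
  -- convergence to zero is not affected.
  have hY : TendstoInMeasure Q (fun n ω => (min (X n ω) 1).toReal) atTop (fun _ => (0 : ℝ)) := by
    refine tendstoInMeasure_of_ne_top fun ε hε hε' => ?_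
    refine tendsto_of_tendsto_of_tendsto_of_le_of_le tendsto_const_nhds
      (h := fun n => (∫⁻ ω, X n ω ∂Q) / ε) ?_ (fun _ => zero_le) fun n => ?_
    · simpa using ENNReal.Tendsto.div_const h (Or.inr hε.ne')
    · refine (measure_mono fun ω hω => ?_).trans
        (meas_ge_le_lintegral_div (hX n).aemeasurable hε.ne' hε')
      have hne : min (X n ω) 1 ≠ ∞ := (min_le_right _ _).trans_lt ENNReal.one_lt_top |>.ne
      simp only [mem_ofPred_eq, edist_zero_right] at hω ⊢
      rw [Real.enorm_eq_ofReal ENNReal.toReal_nonneg, ENNReal.ofReal_toReal hne] at hω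
      exact hω.trans (min_le_left _ _)
  obtain ⟨ns, hns, hae⟩ := hY.exists_seq_tendsto_ae
  refine ⟨ns, hns, hae.mono fun ω hω => ?_⟩
  have h1 : Tendsto (fun i => min (X (ns i) ω) 1) atTop (𝓝 0) := by
    have := ENNReal.tendsto_ofReal hω
    rw [ENNReal.ofReal_zero] at this
    refine this.congr fun i => ENNReal.ofReal_toReal ?_
    exact (min_le_right _ _).trans_lt ENNReal.one_lt_top |>.ne
  refine h1.congr' ?_
  filter_upwards [h1.eventually (gt_mem_nhds zero_lt_one)] with i hi
  rcases min_lt_iff.1 hi with h | h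
  · exact min_eq_left h.le
  · exact absurd h (lt_irrefl _)

/-- The integral over `[t, T]` as an integral of the time-shifted and stopped integrand over the
fixed interval `[0, T]`. -/
theorem integral_eq_integral_shift_stop {φ : ℝ → ℝ} {t T : ℝ} (ht : t ∈ Icc 0 T)
    (hφ : ContinuousOn φ (Icc t T)) :
    ∫ r in t..T, φ r = (∫ s in 0..T, φ (min (t + s) T)) - t * φ T := by
  have hc : ContinuousOn (fun s => φ (min (t + s) T)) (Icc 0 T) := by
    refine hφ.comp (by fun_prop) fun s hs => ⟨le_min ?_ ht.2, min_le_right _ _⟩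
    linarith [hs.1]
  have hT : (0 : ℝ) ≤ T := ht.1.trans ht.2
  have e0 : 0 ≤ T - t := by linarith [ht.2]
  have e1 : T - t ≤ T := by linarith [ht.1]
  have hi1 : IntervalIntegrable (fun s => φ (min (t + s) T)) volume 0 (T - t) := by
    refine ContinuousOn.intervalIntegrable (hc.mono ?_)
    rw [uIcc_of_le e0]; exact Icc_subset_Icc_right e1
  have hi2 : IntervalIntegrable (fun s => φ (min (t + s) T)) volume (T - t) T := by
    refine ContinuousOn.intervalIntegrable (hc.mono ?_)
    rw [uIcc_of_le e1]; exact Icc_subset_Icc_left e0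
  rw [← intervalIntegral.integral_add_adjacent_intervals hi1 hi2]
  have a1 : ∫ s in 0..(T - t), φ (min (t + s) T) = ∫ r in t..T, φ r := by
    have : ∫ s in 0..(T - t), φ (min (t + s) T) = ∫ s in 0..(T - t), φ (t + s) := by
      refine intervalIntegral.integral_congr fun s hs => ?_
      rw [uIcc_of_le e0] at hs
      rw [min_eq_left (by linarith [hs.2])]
    rw [this, intervalIntegral.integral_comp_add_left]
    simp
  -- The stopped time sits at `T` throughout this interval, whose length is `t`.
  have a2 : ∫ s in (T - t)..T, φ (min (t + s) T) = t * φ T := by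
    have : ∫ s in (T - t)..T, φ (min (t + s) T) = ∫ _ in (T - t)..T, φ T := by
      refine intervalIntegral.integral_congr fun s hs => ?_
      rw [uIcc_of_le e1] at hs
      rw [min_eq_right (by linarith [hs.1])]
    rw [this, intervalIntegral.integral_const]
    simp
  rw [a1, a2]; ring

/-- Convergence of the running cost along uniformly convergent paths in a closed set on which the
cost is continuous. -/
theorem tendsto_integral_along_paths {E : Type*} [NormedAddCommGroup E] [ProperSpace E]
    {T : ℝ} {F : Set (ℝ × E)} (hF : IsClosed F) {f : ℝ × E → ℝ} (hf : ContinuousOn f F)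
    {t : ℝ} (ht : t ∈ Icc 0 T) {y : ℝ → E} (hy : ContinuousOn y (Icc t T))
    (hyF : ∀ s ∈ Icc t T, (s, y s) ∈ F)
    {tn : ℕ → ℝ} (htn : ∀ n, tn n ∈ Icc 0 T) (htt : Tendsto tn atTop (𝓝 t))
    {yn : ℕ → ℝ → E} (hyn : ∀ n, ContinuousOn (yn n) (Icc (tn n) T))
    (hynF : ∀ᶠ n in atTop, ∀ s ∈ Icc (tn n) T, (s, yn n s) ∈ F)
    (hunif : ∀ ε : ℝ, 0 < ε → ∀ᶠ n in atTop, ∀ s ∈ Icc 0 T,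
      ‖yn n (min (tn n + s) T) - y (min (t + s) T)‖ < ε) :
    Tendsto (fun n => ∫ r in (tn n)..T, f (r, yn n r)) atTop (𝓝 (∫ r in t..T, f (r, y r))) := by
  have hT : (0 : ℝ) ≤ T := ht.1.trans ht.2
  have hmem : ∀ {a s : ℝ}, a ∈ Icc 0 T → s ∈ Icc 0 T → min (a + s) T ∈ Icc a T := by
    intro a s ha hs
    exact ⟨le_min (by linarith [hs.1]) ha.2, min_le_right _ _⟩
  have hcont : ContinuousOn (fun r => f (r, y r)) (Icc t T) :=
    hf.comp (continuousOn_id.prodMk hy) hyF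
  have hcontn : ∀ᶠ n in atTop, ContinuousOn (fun r => f (r, yn n r)) (Icc (tn n) T) :=
    hynF.mono fun n hn => hf.comp (continuousOn_id.prodMk (hyn n)) hn
  have hpt : ∀ s ∈ Icc 0 T,
      Tendsto (fun n => (min (tn n + s) T, yn n (min (tn n + s) T))) atTop
        (𝓝[F] (min (t + s) T, y (min (t + s) T))) := by
    intro s hs
    refine tendsto_nhdsWithin_iff.2 ⟨Tendsto.prodMk_nhds ?_ ?_, ?_⟩
    · exact (htt.add_const s).min tendsto_const_nhds
    · rw [tendsto_iff_norm_sub_tendsto_zero, Metric.tendsto_atTop']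
      intro ε hε
      obtain ⟨N, hN⟩ := eventually_atTop.1 (hunif ε hε)
      exact ⟨N, fun n hn => by simpa using hN n hn.le s hs⟩
    · exact hynF.mono fun n hn => hn _ (hmem (htn n) hs)
  have hlim : ∀ s ∈ Icc 0 T, Tendsto
      (fun n => f (min (tn n + s) T, yn n (min (tn n + s) T))) atTop
        (𝓝 (f (min (t + s) T, y (min (t + s) T)))) := fun s hs =>
    (hf _ (hyF _ (hmem ht hs))).tendsto.comp (hpt s hs)
  -- The dominating constant: `f` may be unbounded on `F`, but the closed 1-neighbourhood of the
  -- limiting trajectory meets `F` in a compact set, which eventually contains the approximating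
  -- trajectories.
  have hK : IsCompact ((fun s => (s, y s)) '' Icc t T) :=
    isCompact_Icc.image_of_continuousOn (continuousOn_id.prodMk hy)
  obtain ⟨C, hC⟩ := (hK.cthickening (r := 1)).inter_right hF
    |>.exists_bound_of_continuousOn (hf.mono inter_subset_right)
  have hmain : Tendsto (fun n => ∫ s in 0..T, f (min (tn n + s) T, yn n (min (tn n + s) T))) atTop
      (𝓝 (∫ s in 0..T, f (min (t + s) T, y (min (t + s) T)))) := by
    refine intervalIntegral.tendsto_integral_filter_of_dominated_convergence (fun _ => C)
      ?_ ?_ intervalIntegrable_const ?_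
    · filter_upwards [hcontn] with n hn
      rw [uIoc_of_le hT]
      refine ContinuousOn.aestronglyMeasurable ?_ measurableSet_Ioc
      exact ContinuousOn.comp hn (f := fun s => min (tn n + s) T) (by fun_prop)
        fun s hs => hmem (htn n) (Ioc_subset_Icc_self hs)
    · filter_upwards [hynF, hunif 1 one_pos,
        Metric.tendsto_nhds.1 htt 1 one_pos] with n h1 h2 h3
      refine ae_of_all _ fun s hs => ?_
      rw [uIoc_of_le hT] at hs
      have hs' := Ioc_subset_Icc_self hs
      refine hC _ ⟨?_, h1 _ (hmem (htn n) hs')⟩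
      refine Metric.mem_cthickening_of_dist_le _ _ _ _ (mem_image_of_mem _ (hmem ht hs')) ?_
      rw [Prod.dist_eq, dist_eq_norm (yn n _)]
      refine max_le ?_ (h2 s hs').le
      calc dist (min (tn n + s) T) (min (t + s) T)
          ≤ max |tn n + s - (t + s)| |T - T| := abs_min_sub_min_le_max _ _ _ _
        _ ≤ 1 := by
          rw [Real.dist_eq] at h3
          simpa using h3.le
    · refine ae_of_all _ fun s hs => hlim s ?_
      rw [uIoc_of_le hT] at hs
      exact Ioc_subset_Icc_self hs
  have hend : Tendsto (fun n => f (T, yn n T)) atTop (𝓝 (f (T, y T))) := by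
    have := hlim T ⟨hT, le_rfl⟩
    rw [min_eq_right (by linarith [ht.1])] at this
    refine this.congr fun n => ?_
    rw [min_eq_right (by linarith [(htn n).1])]
  rw [integral_eq_integral_shift_stop ht hcont]
  refine (hmain.sub (htt.mul hend)).congr' ?_
  filter_upwards [hcontn] with n hn
  rw [integral_eq_integral_shift_stop (htn n) hn]

end Analysis

/-! ### Survival and the truncated hitting time -/

section HittingTime

variable {Ω : Type*} {d : ℕ} {T : ℝ} {D : Set (TimeSpace d)}
  {Z : ℝ → Space d → ℝ → Ω → Space d} {p : TimeSpace d} {ω : Ω}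

theorem lt_hitTime_iff :
    (T : EReal) < hitTime T D Z p ω ↔ ∀ s ∈ Icc p.1 T, (s, Z p.1 p.2 s ω) ∉ D := by
  constructor
  · intro h s hs hD
    have h1 : hitTime T D Z p ω ≤ (s : EReal) := sInf_le ⟨s, ⟨hs, hD⟩, rfl⟩
    exact absurd (h.trans_le h1) (not_lt.2 (EReal.coe_le_coe_iff.2 hs.2))
  · intro h
    have : {s | s ∈ Icc p.1 T ∧ (s, Z p.1 p.2 s ω) ∈ D} = ∅ :=
      eq_empty_of_forall_notMem fun s hs => h s hs.1 hs.2
    rw [hitTime, this, image_empty, sInf_empty]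
    exact EReal.coe_lt_top T

theorem hitTimeTrunc_of_lt (h : (T : EReal) < hitTime T D Z p ω) :
    hitTimeTrunc T D Z p ω = 2 * T := by
  have : {s | s ∈ Icc p.1 T ∧ (s, Z p.1 p.2 s ω) ∈ D} = ∅ :=
    eq_empty_of_forall_notMem fun s hs => lt_hitTime_iff.1 h s hs.1 hs.2
  rw [hitTimeTrunc, hitTime, this, image_empty, sInf_empty, min_eq_right le_top, EReal.toReal_coe]

theorem hitTimeTrunc_le_of_not_lt (hT : 0 ≤ T) (h : ¬ (T : EReal) < hitTime T D Z p ω) :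
    hitTimeTrunc T D Z p ω ≤ T := by
  rw [hitTimeTrunc]
  have h1 : min (hitTime T D Z p ω) ((2 * T : ℝ) : EReal) ≤ (T : EReal) :=
    (min_le_left _ _).trans (not_lt.1 h)
  generalize min (hitTime T D Z p ω) ((2 * T : ℝ) : EReal) = x at h1
  induction x with
  -- `toReal` sends `⊥` to `0`, whence the assumption `0 ≤ T`.
  | bot => simpa using hT
  | coe x => simpa using h1
  | top => simp at h1

/-- The truncated hitting time jumps from values at most `T` to `2T`, so its convergence forces the
survival events to agree eventually. -/
theorem eventually_lt_hitTime_iff (hT : 0 < T) {q : ℕ → TimeSpace d}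
    (h : Tendsto (fun n => hitTimeTrunc T D Z (q n) ω) atTop (𝓝 (hitTimeTrunc T D Z p ω))) :
    ∀ᶠ n in atTop, ((T : EReal) < hitTime T D Z (q n) ω ↔ (T : EReal) < hitTime T D Z p ω) := by
  by_cases hp : (T : EReal) < hitTime T D Z p ω
  · rw [hitTimeTrunc_of_lt hp] at h
    filter_upwards [h.eventually (lt_mem_nhds (by linarith : T < 2 * T))] with n hn
    refine iff_of_true ?_ hp
    by_contra hc
    exact absurd hn (not_lt.2 (hitTimeTrunc_le_of_not_lt hT.le hc))
  · have h1 := hitTimeTrunc_le_of_not_lt hT.le hp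
    filter_upwards [h.eventually (gt_mem_nhds (by linarith : _ < 2 * T))] with n hn
    refine iff_of_false (fun hc => ?_) hp
    rw [hitTimeTrunc_of_lt hc] at hn
    exact lt_irrefl _ hn

end HittingTime

end ConstrainedDiffusion
namespace ConstrainedDiffusion

/-! ### The solution starts at its prescribed initial value -/

section InitialValue

variable {Ω : Type*} {m : MeasurableSpace Ω} {d d' : ℕ} {Q : Measure Ω} {𝓖 : Filtration ℝ m}
  {t T : ℝ} {W : ℝ → Ω → Space d'}

theorem SimpleProc.integral_initial (H : SimpleProc d d' 𝓖 t T) (ω : Ω) :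
    H.integral W t ω = 0 := by
  refine Finset.sum_eq_zero fun k _ => ?_
  rw [min_eq_right (H.mem _).1, min_eq_right (H.mem _).1, sub_self]
  simp [mulVecE]

/-- Elementary integrals vanish at time `t`, so the uniform approximation error dominates `‖I t‖`,
while it tends to zero in probability. -/
theorem IsItoIntegral.initial_ae {H : ℝ → Ω → Matrix (Fin d) (Fin d') ℝ} {I : ℝ → Ω → Space d}
    (h : IsItoIntegral Q 𝓖 t T W H I) (htT : t ≤ T) : ∀ᵐ ω ∂Q, I t ω = 0 := by
  obtain ⟨Hn, -, hn⟩ := h.approx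
  have key : ∀ ε : ℝ≥0∞, 0 < ε → ∀ᵐ ω ∂Q, ‖I t ω‖ₑ ≤ ε := by
    intro ε hε
    rw [ae_iff]
    refine le_antisymm (ge_of_tendsto' (hn ε hε) fun n => measure_mono fun ω hω => ?_) zero_le
    simp only [not_le, mem_ofPred_eq] at hω ⊢
    refine hω.trans_le ?_
    have := le_iSup₂ (f := fun s (_ : s ∈ Icc t T) => ‖(Hn n).integral W s ω - I s ω‖ₑ) t
      ⟨le_rfl, htT⟩
    simpa [SimpleProc.integral_initial] using this
  have hall : ∀ᵐ ω ∂Q, ∀ n : ℕ, ‖I t ω‖ₑ ≤ ((n : ℝ≥0∞) + 1)⁻¹ :=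
    ae_all_iff.2 fun n => key _ (ENNReal.inv_pos.2 (by finiteness))
  filter_upwards [hall] with ω hω
  rw [← enorm_eq_zero, ← nonpos_iff_eq_zero]
  refine ge_of_tendsto' (x := atTop) ?_ hω
  have := (ENNReal.tendsto_inv_nat_nhds_zero).comp (tendsto_add_atTop_nat 1)
  refine this.congr fun n => ?_
  simp

theorem IsSDESolution.initial_ae {μ : TimeSpace d → Space d}
    {σ : TimeSpace d → Matrix (Fin d) (Fin d') ℝ} {z : Space d} {Z : ℝ → Ω → Space d}
    (h : IsSDESolution Q 𝓖 T W μ σ t z Z) (htT : t ≤ T) : ∀ᵐ ω ∂Q, Z t ω = z := by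
  obtain ⟨I, hI, heq⟩ := h.equation
  filter_upwards [hI.initial_ae htT, heq] with ω h0 h1
  rw [h1 t ⟨le_rfl, htT⟩, h0]
  simp

end InitialValue

/-! ### Measurability of the survival event and of the running cost -/

section Measurability

variable {Ω : Type*} [MeasurableSpace Ω] {d : ℕ} {t T : ℝ} {X : ℝ → Ω → Space d}

/-- The reciprocal distance to the closed set `D` is infinite exactly on `D`. Along a continuous
path over a compact interval it attains its maximum, so the path avoids `D` iff the supremum is
finite, and that supremum is measurable. -/
theorem measurableSet_forall_notMem (htT : t ≤ T) (hm : ∀ s ∈ Icc t T, Measurable (X s))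
    (hc : ∀ ω, ContinuousOn (fun s => X s ω) (Icc t T)) {D : Set (TimeSpace d)} (hD : IsClosed D) :
    MeasurableSet {ω | ∀ s ∈ Icc t T, (s, X s ω) ∉ D} := by
  have hcont : ∀ ω, Continuous fun s : Icc t T => (Metric.infEDist ((s : ℝ), X s ω) D)⁻¹ := by
    intro ω
    have : Continuous fun s : Icc t T => X s ω := continuousOn_iff_continuous_domRestrict.1 (hc ω)
    exact (Metric.continuous_infEDist.comp (continuous_subtype_val.prodMk this)).inv
  have hmeas := measurable_iSup_of_continuous hcont fun s =>
    (Metric.continuous_infEDist.measurable.comp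
      (measurable_const.prodMk (hm s s.2))).inv
  have heq : {ω | ∀ s ∈ Icc t T, (s, X s ω) ∉ D} =
      {ω | ⨆ s : Icc t T, (Metric.infEDist ((s : ℝ), X s ω) D)⁻¹ < ∞} := by
    ext ω
    simp only [mem_ofPred_eq]
    have hmem : ∀ s : ℝ, (s, X s ω) ∈ D ↔ (Metric.infEDist (s, X s ω) D)⁻¹ = ∞ := by
      intro s
      rw [ENNReal.inv_eq_top, ← Metric.mem_closure_iff_infEDist_zero, hD.closure_eq]
    constructor
    · intro h
      have : Nonempty (Icc t T) := ⟨⟨t, le_rfl, htT⟩⟩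
      obtain ⟨s, -, hs⟩ := isCompact_univ.exists_isMaxOn univ_nonempty (hcont ω).continuousOn
      refine lt_of_le_of_lt (iSup_le fun r => hs (mem_univ r)) ?_
      exact lt_top_iff_ne_top.2 fun hh => h s s.2 ((hmem s).2 hh)
    · intro h s hs hsD
      have h1 := le_iSup (fun s : Icc t T => (Metric.infEDist ((s : ℝ), X s ω) D)⁻¹) ⟨s, hs⟩
      rw [(hmem s).1 hsD, top_le_iff] at h1
      exact h.ne h1
  rw [heq]
  exact measurableSet_lt hmeas measurable_const

theorem measurable_integral_along_path (ht : t ∈ Icc 0 T) (hm : ∀ s ∈ Icc t T, Measurable (X s))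
    (hc : ∀ ω, ContinuousOn (fun s => X s ω) (Icc t T)) {f : TimeSpace d → ℝ}
    (hf : Measurable fun p : cyl d T => f p) :
    Measurable fun ω => ∫ s in t..T, f (s, X s ω) := by
  -- Clamping time to `[t, T]` gives an integrand jointly measurable on all of `Ω × ℝ`, with
  -- arguments in the cylinder where `f` is measurable.
  let π : ℝ → Icc t T := projIcc t T ht.2
  have hπ : Measurable π := continuous_projIcc.measurable
  have hX : Measurable (Function.uncurry fun (s : Icc t T) (ω : Ω) => X s ω) :=
    measurable_uncurry_of_continuous_of_measurable
      (fun ω => continuousOn_iff_continuous_domRestrict.1 (hc ω)) fun s => hm s s.2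
  have hφ : Measurable fun q : Ω × ℝ => f ((π q.2 : ℝ), X (π q.2) q.1) := by
    have hmem : ∀ q : Ω × ℝ, ((π q.2 : ℝ), X (π q.2) q.1) ∈ cyl d T := fun q =>
      ⟨⟨ht.1.trans (π q.2).2.1, (π q.2).2.2⟩, mem_univ _⟩
    refine hf.comp (Measurable.subtype_mk (h := hmem) ?_)
    refine (measurable_subtype_coe.comp (hπ.comp measurable_snd)).prodMk ?_
    exact hX.comp ((hπ.comp measurable_snd).prodMk measurable_fst)
  have heq : (fun ω => ∫ s in t..T, f (s, X s ω)) =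
      fun ω => ∫ s in Ioc t T, f ((π s : ℝ), X (π s) ω) := by
    funext ω
    rw [intervalIntegral.integral_of_le ht.2]
    refine setIntegral_congr_fun measurableSet_Ioc fun s hs => ?_
    have : (π s : ℝ) = s := by
      rw [show π s = ⟨s, Ioc_subset_Icc_self hs⟩ from projIcc_of_mem _ _]
    simp only [this]
  rw [heq]
  exact (hφ.stronglyMeasurable.integral_prod_right' (ν := volume.restrict (Ioc t T))).measurable

end Measurability

/-! ### Convergence of the payoff and of `u` -/

section Continuity

variable {Ω : Type*} {m : MeasurableSpace Ω} {Q : Measure Ω} {d : ℕ} {T : ℝ}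
  {D : Set (TimeSpace d)} {Z : ℝ → Space d → ℝ → Ω → Space d}

/-- Along a subsequence, the paths started from convergent initial conditions converge uniformly,
almost surely. -/
theorem FlowContinuous.exists_subseq (hT : 0 < T) (hflow : FlowContinuous Q T Z)
    (hm : ∀ p ∈ cyl d T, ∀ s ∈ Icc p.1 T, Measurable (Z p.1 p.2 s))
    (hc : ∀ p ∈ cyl d T, ∀ ω, ContinuousOn (fun s => Z p.1 p.2 s ω) (Icc p.1 T))
    {p : TimeSpace d} (hp : p ∈ cyl d T) {q : ℕ → TimeSpace d} (hq : ∀ n, q n ∈ cyl d T)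
    (hqp : Tendsto q atTop (𝓝 p)) :
    ∃ ns : ℕ → ℕ, StrictMono ns ∧ ∀ᵐ ω ∂Q, ∀ ε : ℝ, 0 < ε → ∀ᶠ n in atTop, ∀ s ∈ Icc 0 T,
      ‖Z (q (ns n)).1 (q (ns n)).2 (min ((q (ns n)).1 + s) T) ω
        - Z p.1 p.2 (min (p.1 + s) T) ω‖ < ε := by
  have hmem : ∀ {a : TimeSpace d} {s : ℝ}, a ∈ cyl d T → s ∈ Icc 0 T →
      min (a.1 + s) T ∈ Icc a.1 T := by
    intro a s ha hs
    exact ⟨le_min (by linarith [hs.1]) ha.1.2, min_le_right _ _⟩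
  have hcs : ∀ a ∈ cyl d T, ∀ ω, Continuous fun s : Icc (0 : ℝ) T =>
      Z a.1 a.2 (min (a.1 + s) T) ω := by
    intro a ha ω
    exact (hc a ha ω).comp_continuous (by fun_prop) fun s => hmem ha s.2
  have hmeas : ∀ n, Measurable fun ω => ⨆ s ∈ Icc (0 : ℝ) T,
      ‖Z (q n).1 (q n).2 (min ((q n).1 + s) T) ω - Z p.1 p.2 (min (p.1 + s) T) ω‖ₑ := by
    intro n
    simp only [iSup_subtype']
    refine measurable_iSup_of_continuous
      (fun ω => ((hcs _ (hq n) ω).sub (hcs p hp ω)).enorm) fun s => ?_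
    exact ((hm _ (hq n) _ (hmem (hq n) s.2)).sub (hm p hp _ (hmem hp s.2))).enorm
  obtain ⟨ns, hns, hae⟩ :=
    exists_subseq_ae_tendsto_zero_of_lintegral hmeas (hflow T hT p hp q hq hqp)
  refine ⟨ns, hns, hae.mono fun ω hω ε hε => ?_⟩
  filter_upwards [hω.eventually (gt_mem_nhds (ENNReal.ofReal_pos.2 hε))] with n hn s hs
  have h1 := (le_iSup₂ (f := fun s (_ : s ∈ Icc (0 : ℝ) T) =>
    ‖Z (q (ns n)).1 (q (ns n)).2 (min ((q (ns n)).1 + s) T) ω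
      - Z p.1 p.2 (min (p.1 + s) T) ω‖ₑ) s hs).trans_lt hn
  rw [← ofReal_norm] at h1
  exact (ENNReal.ofReal_lt_ofReal_iff hε).1 h1

theorem HitTimeContinuousAt.exists_subseq {p : TimeSpace d} (h : HitTimeContinuousAt Q T D Z p)
    {q : ℕ → TimeSpace d} (hq : ∀ n, q n ∈ contSet T D) (hqp : Tendsto q atTop (𝓝 p)) :
    ∃ ns : ℕ → ℕ, StrictMono ns ∧ ∀ᵐ ω ∂Q,
      Tendsto (fun n => hitTimeTrunc T D Z (q (ns n)) ω) atTop
        (𝓝 (hitTimeTrunc T D Z p ω)) := by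
  suffices hmeas : TendstoInMeasure Q (fun n ω => hitTimeTrunc T D Z (q n) ω) atTop
      (fun ω => hitTimeTrunc T D Z p ω) from hmeas.exists_seq_tendsto_ae
  rw [tendstoInMeasure_iff_dist]
  intro ε hε
  -- Convergence in measure uses `ε ≤ dist`, (R) a strict inequality; `ε / 2` bridges the two.
  refine tendsto_of_tendsto_of_tendsto_of_le_of_le tendsto_const_nhds
    (h q hq hqp (ε / 2) (half_pos hε)) (fun _ => zero_le) fun n => measure_mono fun ω hω => ?_
  simp only [mem_ofPred_eq, Real.dist_eq] at hω ⊢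
  linarith

/-- The random variable whose expectation is `uFun`. -/
noncomputable def payoff (T : ℝ) (D : Set (TimeSpace d)) (f : TimeSpace d → ℝ) (g : Space d → ℝ)
    (Z : ℝ → Space d → ℝ → Ω → Space d) (p : TimeSpace d) : Ω → ℝ :=
  {ω | (T : EReal) < hitTime T D Z p ω}.indicator
    (fun ω => Real.exp (-(1 / 2) * (∫ s in p.1..T, f (s, Z p.1 p.2 s ω))
      - (1 / 2) * g (Z p.1 p.2 T ω)))

theorem uFun_eq_integral_payoff {f : TimeSpace d → ℝ} {g : Space d → ℝ} (p : TimeSpace d) :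
    uFun Q T D f g Z p = ∫ ω, payoff T D f g Z p ω ∂Q := rfl

theorem measurable_payoff (hD : IsClosed D) {f : TimeSpace d → ℝ} {g : Space d → ℝ}
    (hf : Measurable fun p : cyl d T => f p) (hg : Measurable g) {p : TimeSpace d}
    (hp : p ∈ cyl d T) (hm : ∀ s ∈ Icc p.1 T, Measurable (Z p.1 p.2 s))
    (hc : ∀ ω, ContinuousOn (fun s => Z p.1 p.2 s ω) (Icc p.1 T)) :
    Measurable (payoff T D f g Z p) := by
  refine Measurable.indicator ?_ ?_
  · exact (((measurable_integral_along_path hp.1 hm hc hf).const_mul _).sub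
      ((hg.comp (hm T ⟨hp.1.2, le_rfl⟩)).const_mul _)).exp
  · simp only [lt_hitTime_iff]
    exact measurableSet_forall_notMem hp.1.2 hm hc hD

theorem norm_payoff_le_one {f : TimeSpace d → ℝ} {g : Space d → ℝ}
    (hf : ∀ p ∈ cyl d T, 0 ≤ f p) (hg : ∀ x, 0 ≤ g x) {p : TimeSpace d} (hp : p ∈ cyl d T)
    (ω : Ω) : ‖payoff T D f g Z p ω‖ ≤ 1 := by
  refine (norm_indicator_le_norm_self _ _).trans ?_
  rw [Real.norm_eq_abs, Real.abs_exp, Real.exp_le_one_iff]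
  have h1 : 0 ≤ ∫ s in p.1..T, f (s, Z p.1 p.2 s ω) :=
    intervalIntegral.integral_nonneg hp.1.2 fun s hs =>
      hf _ ⟨⟨hp.1.1.trans hs.1, hs.2⟩, mem_univ _⟩
  linarith [hg (Z p.1 p.2 T ω)]

/-- Pathwise convergence of the payoff. -/
theorem tendsto_payoff (hT : 0 < T) {f : TimeSpace d → ℝ} {g : Space d → ℝ}
    (hf : ContinuousOn f (closure (contSet T D)))
    (hg : ContinuousOn (fun p : TimeSpace d => g p.2) (closure (slice (contSet T D) T)))
    (hc : ∀ p ∈ cyl d T, ∀ ω, ContinuousOn (fun s => Z p.1 p.2 s ω) (Icc p.1 T))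
    {p : TimeSpace d} (hp : p ∈ cyl d T) {q : ℕ → TimeSpace d} (hq : ∀ n, q n ∈ cyl d T)
    (hqp : Tendsto q atTop (𝓝 p)) {ω : Ω}
    (hunif : ∀ ε : ℝ, 0 < ε → ∀ᶠ n in atTop, ∀ s ∈ Icc 0 T,
      ‖Z (q n).1 (q n).2 (min ((q n).1 + s) T) ω - Z p.1 p.2 (min (p.1 + s) T) ω‖ < ε)
    (hhit : Tendsto (fun n => hitTimeTrunc T D Z (q n) ω) atTop
      (𝓝 (hitTimeTrunc T D Z p ω))) :
    Tendsto (fun n => payoff T D f g Z (q n) ω) atTop (𝓝 (payoff T D f g Z p ω)) := by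
  have hiff := eventually_lt_hitTime_iff hT hhit
  by_cases hsurv : (T : EReal) < hitTime T D Z p ω
  · have hC : ∀ a ∈ cyl d T, (T : EReal) < hitTime T D Z a ω →
        ∀ s ∈ Icc a.1 T, (s, Z a.1 a.2 s ω) ∈ contSet T D := fun a ha h s hs =>
      ⟨⟨⟨ha.1.1.trans hs.1, hs.2⟩, mem_univ _⟩, lt_hitTime_iff.1 h s hs⟩
    have hev : ∀ᶠ n in atTop, (T : EReal) < hitTime T D Z (q n) ω :=
      hiff.mono fun n hn => hn.2 hsurv
    have hint := tendsto_integral_along_paths isClosed_closure hf hp.1 (hc p hp ω)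
      (fun s hs => subset_closure (hC p hp hsurv s hs)) (fun n => (hq n).1)
      ((continuous_fst.tendsto p).comp hqp) (fun n => hc (q n) (hq n) ω)
      (hev.mono fun n hn s hs => subset_closure (hC _ (hq n) hn s hs)) hunif
    have hZT : Tendsto (fun n => Z (q n).1 (q n).2 T ω) atTop (𝓝 (Z p.1 p.2 T ω)) := by
      rw [tendsto_iff_norm_sub_tendsto_zero, Metric.tendsto_atTop']
      intro ε hε
      obtain ⟨N, hN⟩ := eventually_atTop.1 (hunif ε hε)
      refine ⟨N, fun n hn => ?_⟩
      have := hN n hn.le T ⟨hT.le, le_rfl⟩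
      rw [min_eq_right (by linarith [(hq n).1.1]), min_eq_right (by linarith [hp.1.1])] at this
      simpa using this
    have hsl : ∀ a ∈ cyl d T, (T : EReal) < hitTime T D Z a ω →
        (T, Z a.1 a.2 T ω) ∈ closure (slice (contSet T D) T) := fun a ha h =>
      subset_closure ⟨hC a ha h T ⟨ha.1.2, le_rfl⟩, rfl, mem_univ _⟩
    have hgT : Tendsto (fun n => g (Z (q n).1 (q n).2 T ω)) atTop (𝓝 (g (Z p.1 p.2 T ω))) := by
      -- Continuity of `g` is only relative to the closure of `𝒞_T`; surviving paths end in `𝒞_T`.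
      have h1 : Tendsto (fun n => (T, Z (q n).1 (q n).2 T ω)) atTop
          (𝓝[closure (slice (contSet T D) T)] (T, Z p.1 p.2 T ω)) :=
        tendsto_nhdsWithin_iff.2 ⟨tendsto_const_nhds.prodMk_nhds hZT,
          hev.mono fun n hn => hsl _ (hq n) hn⟩
      exact (hg _ (hsl p hp hsurv)).tendsto.comp h1
    rw [payoff, indicator_of_mem (by exact hsurv)]
    refine (((hint.const_mul (-(1 / 2))).sub (hgT.const_mul (1 / 2))).rexp).congr' ?_
    filter_upwards [hev] with n hn
    rw [payoff, indicator_of_mem (by exact hn)]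
  · rw [payoff, indicator_of_notMem (by exact hsurv)]
    refine tendsto_const_nhds.congr' ?_
    filter_upwards [hiff] with n hn
    rw [payoff, indicator_of_notMem (by exact fun h => hsurv (hn.1 h))]

/-- If the truncated hitting times converge in probability at `p`, then `u` converges to `u p` along
sequences in `𝒞` converging to `p`. -/
theorem tendsto_uFun [IsFiniteMeasure Q] (hT : 0 < T) (hD : IsClosed D)
    (hm : ∀ p ∈ cyl d T, ∀ s ∈ Icc p.1 T, Measurable (Z p.1 p.2 s))
    (hc : ∀ p ∈ cyl d T, ∀ ω, ContinuousOn (fun s => Z p.1 p.2 s ω) (Icc p.1 T))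
    {f : TimeSpace d → ℝ} (hf_meas : Measurable fun p : cyl d T => f p)
    (hf_nonneg : ∀ p ∈ cyl d T, 0 ≤ f p) {g : Space d → ℝ} (hg_meas : Measurable g)
    (hg_nonneg : ∀ x, 0 ≤ g x) (hf : ContinuousOn f (closure (contSet T D)))
    (hg : ContinuousOn (fun p : TimeSpace d => g p.2) (closure (slice (contSet T D) T)))
    (hflow : FlowContinuous Q T Z) {p : TimeSpace d} (hp : p ∈ cyl d T)
    (hR : HitTimeContinuousAt Q T D Z p) {q : ℕ → TimeSpace d} (hq : ∀ n, q n ∈ contSet T D)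
    (hqp : Tendsto q atTop (𝓝 p)) :
    Tendsto (fun n => uFun Q T D f g Z (q n)) atTop (𝓝 (uFun Q T D f g Z p)) := by
  -- Given any subsequence `ms`, a first extraction `ns` yields uniform convergence of paths and a
  -- second, `ks`, convergence of hitting times, both almost surely.
  refine tendsto_of_subseq_tendsto fun ms hms => ?_
  obtain ⟨ns, hns, h1⟩ := hflow.exists_subseq hT hm hc hp (fun n => (hq (ms n)).1)
    (hqp.comp hms)
  have hqp' : Tendsto (fun n => q (ms (ns n))) atTop (𝓝 p) :=
    (hqp.comp hms).comp hns.tendsto_atTop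
  obtain ⟨ks, hks, h2⟩ := hR.exists_subseq (fun n => hq (ms (ns n))) hqp'
  refine ⟨fun n => ns (ks n), ?_⟩
  simp only [uFun_eq_integral_payoff]
  refine tendsto_integral_filter_of_dominated_convergence (fun _ => 1)
    (Eventually.of_forall fun n => ?_) (Eventually.of_forall fun n => ae_of_all _ fun ω => ?_)
    (integrable_const 1) ?_
  · exact (measurable_payoff hD hf_meas hg_meas (hq _).1 (hm _ (hq _).1)
      (hc _ (hq _).1)).aestronglyMeasurable
  · exact norm_payoff_le_one hf_nonneg hg_nonneg (hq _).1 ω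
  · filter_upwards [h1, h2] with ω hω1 hω2
    exact tendsto_payoff hT hf hg hc hp (fun n => (hq _).1) (hqp'.comp hks.tendsto_atTop)
      (fun ε hε => hks.tendsto_atTop.eventually (hω1 ε hε)) hω2

/-- A path started in `D` almost surely hits it at its starting time, hence no later than `T`. -/
theorem uFun_eq_zero_of_mem {f : TimeSpace d → ℝ} {g : Space d → ℝ} {p : TimeSpace d}
    (hp : p ∈ cyl d T) (hpD : p ∈ D) (h0 : ∀ᵐ ω ∂Q, Z p.1 p.2 p.1 ω = p.2) :
    uFun Q T D f g Z p = 0 := by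
  rw [uFun_eq_integral_payoff]
  refine integral_eq_zero_of_ae (h0.mono fun ω hω => indicator_of_notMem ?_ _)
  intro h
  refine lt_hitTime_iff.1 h p.1 ⟨le_rfl, hp.1.2⟩ ?_
  rw [hω]
  exact hpD

/-- `u` is continuous on `𝒪 ∖ ∂𝒞_T` as soon as it vanishes on `𝒟` and is sequentially continuous
along `𝒞` at the points of `𝒞`, of the lateral boundary and of `𝒟°_T`. -/
theorem continuousOn_of_tendsto_contSet (hD : IsClosed D) {u : TimeSpace d → ℝ}
    (hzero : ∀ p ∈ cyl d T, p ∈ D → u p = 0)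
    (hlim : ∀ p ∈ contSet T D ∪ lateralBdry T D ∪ terminalInt T D, ∀ q : ℕ → TimeSpace d,
      (∀ n, q n ∈ contSet T D) → Tendsto q atTop (𝓝 p) →
      Tendsto (fun n => u (q n)) atTop (𝓝 (u p))) :
    ContinuousOn u (cyl d T \ terminalBdry T D) := by
  intro p hp
  have hwithin : p ∈ contSet T D ∪ lateralBdry T D ∪ terminalInt T D →
      Tendsto u (𝓝[contSet T D] p) (𝓝 (u p)) := by
    intro hpm
    refine tendsto_of_seq_tendsto fun q hq => ?_
    obtain ⟨hq1, hq2⟩ := tendsto_nhdsWithin_iff.1 hq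
    obtain ⟨N, hN⟩ := eventually_atTop.1 hq2
    -- Dropping the first `N` terms leaves a sequence lying entirely in `𝒞`.
    rw [← tendsto_add_atTop_iff_nat N]
    exact hlim p hpm (fun n => q (n + N)) (fun n => hN _ (Nat.le_add_left N n))
      ((tendsto_add_atTop_iff_nat N).2 hq1)
  have hcyl : Tendsto u (𝓝[cyl d T] p) (𝓝 (u p)) := by
    by_cases hpD : p ∈ D
    · have hpart : Tendsto u (𝓝[contSet T D] p) (𝓝 (u p)) := by
        by_cases hcl : p ∈ closure (contSet T D)
        · refine hwithin ?_
          -- Before `T` the point is on the lateral boundary; at `T`, exclusion of `∂𝒞_T` puts it in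
          -- `𝒟°_T`.
          rcases hp.1.1.2.lt_or_eq with hlt | heq
          · exact Or.inl (Or.inr ⟨⟨hcl, hpD⟩, ⟨hp.1.1.1, hlt⟩, mem_univ _⟩)
          · have hsl : p ∈ slice D T := ⟨hpD, heq, mem_univ _⟩
            exact Or.inr ⟨hsl, fun h => hp.2 ⟨hsl, h⟩⟩
        · rw [notMem_closure_iff_nhdsWithin_eq_bot.1 hcl]
          exact tendsto_bot
      have hpart' : Tendsto u (𝓝[cyl d T ∩ D] p) (𝓝 (u p)) := by
        rw [hzero p hp.1 hpD]
        refine tendsto_const_nhds.congr' ?_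
        filter_upwards [self_mem_nhdsWithin] with q hq
        exact (hzero q hq.1 hq.2).symm
      rw [← inter_union_sdiff (cyl d T) D, nhdsWithin_union]
      exact hpart'.sup hpart
    · have hpC : p ∈ contSet T D := ⟨hp.1, hpD⟩
      -- Off the closed set `D`, nearby points of `𝒪` all belong to `𝒞`.
      have : 𝓝[contSet T D] p = 𝓝[cyl d T] p :=
        nhdsWithin_inter_of_mem' (nhdsWithin_le_nhds (hD.isOpen_compl.mem_nhds hpD))
      rw [← this]
      exact hwithin (Or.inl (Or.inl hpC))
  exact hcyl.mono_left (nhdsWithin_mono p sdiff_subset)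

end Continuity

end ConstrainedDiffusion

/-! ### The theorem -/

open ConstrainedDiffusion in
theorem proposition4p1 {Ω : Type*} {m : MeasurableSpace Ω} (Q : Measure Ω)
    [IsProbabilityMeasure Q] (d d' : ℕ) (T : ℝ) (hT : 0 < T)
    (D : Set (TimeSpace d)) (hDclosed : IsClosed D) (hDsub : D ⊆ cyl d T)
    (μ : TimeSpace d → Space d) (σ : TimeSpace d → Matrix (Fin d) (Fin d') ℝ)
    (hcoeff : CoeffConditions T μ σ)
    (𝓖 : Filtration ℝ m) (W : ℝ → Ω → Space d') (hW : IsBrownianOn Q 𝓖 T W)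
    (Z : ℝ → Space d → ℝ → Ω → Space d)
    (hZ : ∀ t ∈ Icc 0 T, ∀ z : Space d, IsSDESolution Q 𝓖 T W μ σ t z (Z t z))
    (f : TimeSpace d → ℝ) (hf_meas : Measurable (fun p : cyl d T => f p))
    (hf_nonneg : ∀ p ∈ cyl d T, 0 ≤ f p)
    (g : Space d → ℝ) (hg_meas : Measurable g) (hg_nonneg : ∀ x, 0 ≤ g x)
    (hf_cont : ContinuousOn f (closure (contSet T D)))
    (hg_cont : ContinuousOn (fun p : TimeSpace d => g p.2) (closure (slice (contSet T D) T)))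
    (hflow : FlowContinuous Q T Z)
    (havoid : AvoidsTerminalBdry Q T D Z) :
    (∀ p ∈ contSet T D, HitTimeContinuousAt Q T D Z p →
      ∀ q : ℕ → TimeSpace d, (∀ n, q n ∈ contSet T D) → Tendsto q atTop (𝓝 p) →
        Tendsto (fun n => uFun Q T D f g Z (q n)) atTop (𝓝 (uFun Q T D f g Z p))) ∧
    (∀ p ∈ lateralBdry T D ∪ terminalInt T D, HitTimeContinuousAt Q T D Z p →
      uFun Q T D f g Z p = 0 ∧
      ∀ q : ℕ → TimeSpace d, (∀ n, q n ∈ contSet T D) → Tendsto q atTop (𝓝 p) →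
        Tendsto (fun n => uFun Q T D f g Z (q n)) atTop (𝓝 0)) ∧
    ((∀ p ∈ contSet T D ∪ lateralBdry T D ∪ terminalInt T D, HitTimeContinuousAt Q T D Z p) →
      ContinuousOn (uFun Q T D f g Z) (cyl d T \ terminalBdry T D)) := by
  have hm : ∀ p ∈ cyl d T, ∀ s ∈ Icc p.1 T, Measurable (Z p.1 p.2 s) := fun p hp s hs =>
    ((hZ p.1 hp.1 p.2).adapted s hs).mono (𝓖.le s) le_rfl
  have hc : ∀ p ∈ cyl d T, ∀ ω, ContinuousOn (fun s => Z p.1 p.2 s ω) (Icc p.1 T) := fun p hp =>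
    (hZ p.1 hp.1 p.2).continuous_paths
  have hzero : ∀ p ∈ cyl d T, p ∈ D → uFun Q T D f g Z p = 0 := fun p hp hpD =>
    uFun_eq_zero_of_mem hp hpD ((hZ p.1 hp.1 p.2).initial_ae hp.1.2)
  -- Sequences run in `𝒞`, but the limit `p` may be anywhere in `𝒪`; thus (a) and (b) differ only in
  -- the value of `u` at `p`.
  have hlim : ∀ p ∈ cyl d T, HitTimeContinuousAt Q T D Z p → ∀ q : ℕ → TimeSpace d,
      (∀ n, q n ∈ contSet T D) → Tendsto q atTop (𝓝 p) →
        Tendsto (fun n => uFun Q T D f g Z (q n)) atTop (𝓝 (uFun Q T D f g Z p)) :=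
    fun p hp hR q hq hqp => tendsto_uFun hT hDclosed hm hc hf_meas hf_nonneg hg_meas hg_nonneg
      hf_cont hg_cont hflow hp hR hq hqp
  have hbdry : ∀ p ∈ lateralBdry T D ∪ terminalInt T D, p ∈ D := by
    rintro p (h | h)
    exacts [h.1.2, h.1.1]
  refine ⟨fun p hp => hlim p hp.1, fun p hp hR => ?_, fun hR => ?_⟩
  · have hpD := hbdry p hp
    have h0 := hzero p (hDsub hpD) hpD
    exact ⟨h0, fun q hq hqp => h0 ▸ hlim p (hDsub hpD) hR q hq hqp⟩
  · refine continuousOn_of_tendsto_contSet hDclosed hzero fun p hp => hlim p ?_ (hR p hp)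
    rcases hp with (hp | hp) | hp
    exacts [hp.1, hDsub (hbdry p (Or.inl hp)), hDsub (hbdry p (Or.inr hp))]
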